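/- Setting. Let $I_0\subset\mathbb R^D$ be compact with diameter $1$ and non-empty interior, let $0<\tau<1$. For a set $I\subset\mathbb R^D$, we say that $J_1,\dots,J_t\subseteq I$ are $\tau$-separated $r$-similarities of $I$ if each $J_i$ is the image of $I$ under a similarity of ratio $r$ and $d(J_i,J_j)\ge \tau\, r\,\mathrm{diam}(I)$ for $i\ne j$. For each integer $t\ge 2$ let $r_t\in(0,1/2]$ be such that for every $0<r\le r_t$ there exist $t$ sets that are $\tau$-separated $r$-similarities of $I_0$. Let $\mathcal S_t=\{p\in\mathbb R^t: p^{(i)}>0,\ \sum_i p^{(i)}=1\}$, let $\Omega_0=\bigcup_{t\ge2}(0,r_t]\times\mathcal S_t$ (a disjoint union), let $\pi$ be a Borel probability measure on $\Omega_0$ and let $\mathbb P=\pi^{\mathbb N}$ on $\Omega=\Omega_0^{\mathbb N}$. The $n$-th coordinate of $\omega\in\Omega$ is written $(r_n,p_n)$, $p_n=(p_n^{(1)},\dots,p_n^{(T_n)})\in\mathcal S_{T_n}$. Put $$X_n=-\log\max_j p_n^{(j)},\qquad Y_n=-\log\min_j p_n^{(j)},\qquad Z_n=-\log r_n .$$ Given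 $\omega\in\Omega$, carry out a Moran construction: $I_0$ is the only Moran set of step $0$, and in each Moran set $I$ of step $n$ choose (in any way) $T_{n+1}$ sets $I^{(1)},\dots,I^{(T_{n+1})}$ that are $\tau$-separated $r_{n+1}$-similarities of $I$; these are the Moran sets of step $n+1$ contained in $I$. The Moran measure $\mu_\omega$ is the unique Borel probability measure on $\mathbb R^D$ with $\mu_\omega(I_0)=1$ and $\mu_\omega(I^{(j)})=\mu_\omega(I)\,p_{n+1}^{(j)}$ for every Moran set $I$ of step $n$ and every $j$. Dimensions. For a Borel probability measure $\mu$ and $0<\theta<1$, let $\overline{\dim}_{\theta}\,\mu$ be the infimum of those $d\in\mathbb R$ for which there are $C_1,C_2>0$ ($C_1<1$) such that $\mu(B(x,R))/\mu(B(x,r))\le C_2(R/r)^d$ for all $x\in\mathrm{supp}\,\mu$ and all $0<r<R^{1/\theta}\le R\le C_1$, and let $\underline{\dim}_{\theta}\,\mu$ be the supremum of those $d\in\mathbb R$ for which there are such $C_1,C_2$ with $\mu(B(x,R))/\mu(B(x,r))\ge C_2(R/r)^d$ for all such $x,r,R$. The upper and lower quasi-Assouad dimensions are $\dim_{qA}\mu=\lim_{\theta\to1^-}\overline{\dim}_{\theta}\,\mu$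 and $\dim_{qL}\mu=\lim_{\theta\to1^-}\underline{\dim}_{\theta}\,\mu$. The Frostman dimension $\dim_F\mu$ is the supremum of the $s\ge0$ for which there is $C>0$ with $\mu(B(x,r))\le Cr^s$ for all $x\in\mathrm{supp}\,\mu$, $0<r<1$; the upper Minkowski dimension $\overline{\dim}_M\mu$ is the infimum of the $s\ge0$ for which there is $c>0$ with $\mu(B(x,r))\ge cr^s$ for all $x\in\mathrm{supp}\,\mu$, $0<r<1$. All dimensions take values in $[-\infty,\infty]$. Statement. Assume that there is $A>0$ such that $\mathbb E(e^{\lambda X_1})$, $\mathbb E(e^{\lambda Y_1})$ and $\mathbb E(e^{\lambda Z_1})$ are finite for all $|\lambda|\le A$. Then for $\mathbb P$-almost every $\omega$, for every choice of the Moran sets in the construction for $\omega$, $$\dim_{qL}\mu_\omega=\dim_F\mu_\omega=\frac{\mathbb E(X_1)}{\mathbb E(Z_1)},\qquad \dim_{qA}\mu_\omega=\overline{\dim}_M\mu_\omega=\frac{\mathbb E(Y_1)}{\mathbb E(Z_1)} .$$ -/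

import Mathlib

open MeasureTheory Filter Set
open scoped Topology

namespace RandomMoran

noncomputable section

/-! ### Dimensions of measures -/

section Dimensions

variable {E : Type*} [PseudoMetricSpace E] [MeasurableSpace E]

/-- The exponents `d` such that, for some constants `C₁, C₂ > 0`,
`μ(B(x,R)) / μ(B(x,r)) ≤ C₂ (R/r) ^ d` for all `0 < r < R ^ (1 + Φ(R)) ≤ R ≤ C₁` and all `x` in the
support of `μ`. As `Φ` is a function on `(0,1)`, only `C₁ < 1` is considered. -/
def upperPhiExponents (Φ : ℝ → ℝ) (μ : Measure E) : Set ℝ :=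
  {d | ∃ C₁ C₂ : ℝ, 0 < C₁ ∧ C₁ < 1 ∧ 0 < C₂ ∧
    ∀ r R : ℝ, 0 < r → r < R ^ (1 + Φ R) → R ^ (1 + Φ R) ≤ R → R ≤ C₁ →
      ∀ x ∈ μ.support,
        μ.real (Metric.ball x R) / μ.real (Metric.ball x r) ≤ C₂ * (R / r) ^ d}

/-- The exponents `d` such that, for some constants `C₁, C₂ > 0`,
`μ(B(x,R)) / μ(B(x,r)) ≥ C₂ (R/r) ^ d` for all `0 < r < R ^ (1 + Φ(R)) ≤ R ≤ C₁` and all `x` in the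
support of `μ`. -/
def lowerPhiExponents (Φ : ℝ → ℝ) (μ : Measure E) : Set ℝ :=
  {d | ∃ C₁ C₂ : ℝ, 0 < C₁ ∧ C₁ < 1 ∧ 0 < C₂ ∧
    ∀ r R : ℝ, 0 < r → r < R ^ (1 + Φ R) → R ^ (1 + Φ R) ≤ R → R ≤ C₁ →
      ∀ x ∈ μ.support,
        C₂ * (R / r) ^ d ≤ μ.real (Metric.ball x R) / μ.real (Metric.ball x r)}

/-- The upper `Φ`-dimension of a measure (an extended real number; `⊤` if there is no admissible
exponent). -/
def upperPhiDim (Φ : ℝ → ℝ) (μ : Measure E) : EReal :=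
  sInf ((fun d : ℝ => (d : EReal)) '' upperPhiExponents Φ μ)

/-- The lower `Φ`-dimension of a measure. -/
def lowerPhiDim (Φ : ℝ → ℝ) (μ : Measure E) : EReal :=
  sSup ((fun d : ℝ => (d : EReal)) '' lowerPhiExponents Φ μ)

/-- The constant dimension function `Φ_θ = 1/θ - 1` of the `θ`-Assouad spectrum. -/
def phiTheta (θ : ℝ) : ℝ → ℝ := fun _ => 1 / θ - 1

/-- The upper quasi-Assouad dimension: the limit of the upper `Φ_θ`-dimensions as `θ → 1`
from below (the limit exists, see `tendsto_upperQuasiAssouadDim`). -/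
def upperQuasiAssouadDim (μ : Measure E) : EReal :=
  limUnder (𝓝[<] (1 : ℝ)) (fun θ => upperPhiDim (phiTheta θ) μ)

/-- The lower quasi-Assouad dimension: the limit of the lower `Φ_θ`-dimensions as `θ → 1`
from below (the limit exists, see `tendsto_lowerQuasiAssouadDim`). -/
def lowerQuasiAssouadDim (μ : Measure E) : EReal :=
  limUnder (𝓝[<] (1 : ℝ)) (fun θ => lowerPhiDim (phiTheta θ) μ)

/-- The Frostman dimension: the supremum of the `s ≥ 0` such that, for some `C > 0`,
`μ(B(x,r)) ≤ C r ^ s` for all `x` in the support of `μ` and all `0 < r < 1`. -/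
def frostmanDim (μ : Measure E) : EReal :=
  sSup ((fun s : ℝ => (s : EReal)) '' {s : ℝ | 0 ≤ s ∧ ∃ C : ℝ, 0 < C ∧
    ∀ x ∈ μ.support, ∀ r : ℝ, 0 < r → r < 1 → μ.real (Metric.ball x r) ≤ C * r ^ s})

/-- The upper Minkowski dimension of a measure: the infimum of the `s ≥ 0` such that, for some
`c > 0`, `μ(B(x,r)) ≥ c r ^ s` for all `x` in the support of `μ` and all `0 < r < 1`. -/
def upperMinkowskiDim (μ : Measure E) : EReal :=
  sInf ((fun s : ℝ => (s : EReal)) '' {s : ℝ | 0 ≤ s ∧ ∃ c : ℝ, 0 < c ∧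
    ∀ x ∈ μ.support, ∀ r : ℝ, 0 < r → r < 1 → c * r ^ s ≤ μ.real (Metric.ball x r)})

theorem rpow_phiTheta_le {θ₁ θ₂ R C : ℝ} (h₁ : 0 < θ₁) (h : θ₁ ≤ θ₂) (hR : 0 < R) (hC : R ≤ C)
    (hC1 : C < 1) : R ^ (1 + phiTheta θ₁ R) ≤ R ^ (1 + phiTheta θ₂ R) := by
  apply Real.rpow_le_rpow_of_exponent_ge hR (by linarith)
  have := one_div_le_one_div_of_le h₁ h
  simp only [phiTheta]
  linarith

theorem rpow_phiTheta_le_self {θ R C : ℝ} (h₁ : 0 < θ) (h : θ < 1) (hR : 0 < R) (hC : R ≤ C)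
    (hC1 : C < 1) : R ^ (1 + phiTheta θ R) ≤ R := by
  have := rpow_phiTheta_le h₁ h.le hR hC hC1
  simpa [phiTheta] using this

theorem pos_of_lt_rpow {r R e : ℝ} (hr : 0 < r) (h : r < R ^ e) (h' : R ^ e ≤ R) : 0 < R := by
  linarith

theorem upperPhiDim_mono (μ : Measure E) :
    MonotoneOn (fun θ => upperPhiDim (phiTheta θ) μ) (Ioo 0 1) := by
  intro a ha b hb hab
  apply sInf_le_sInf
  apply image_mono
  rintro d ⟨C₁, C₂, h1, h2, h3, H⟩
  refine ⟨C₁, C₂, h1, h2, h3, fun r R hr hrR hR hC x hx => ?_⟩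
  have hpos := pos_of_lt_rpow hr hrR hR
  exact H r R hr (hrR.trans_le (rpow_phiTheta_le ha.1 hab hpos hC h2))
    (rpow_phiTheta_le_self hb.1 hb.2 hpos hC h2) hC x hx

theorem lowerPhiDim_anti (μ : Measure E) :
    AntitoneOn (fun θ => lowerPhiDim (phiTheta θ) μ) (Ioo 0 1) := by
  intro a ha b hb hab
  apply sSup_le_sSup
  apply image_mono
  rintro d ⟨C₁, C₂, h1, h2, h3, H⟩
  refine ⟨C₁, C₂, h1, h2, h3, fun r R hr hrR hR hC x hx => ?_⟩
  have hpos := pos_of_lt_rpow hr hrR hR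
  exact H r R hr (hrR.trans_le (rpow_phiTheta_le ha.1 hab hpos hC h2))
    (rpow_phiTheta_le_self hb.1 hb.2 hpos hC h2) hC x hx

theorem tendsto_upperQuasiAssouadDim (μ : Measure E) :
    Tendsto (fun θ => upperPhiDim (phiTheta θ) μ) (𝓝[<] (1 : ℝ)) (𝓝 (upperQuasiAssouadDim μ)) := by
  have := (upperPhiDim_mono μ).tendsto_nhdsWithin_Ioo_left
    (nonempty_Ioo.2 zero_lt_one) (OrderTop.bddAbove _)
  exact tendsto_nhds_limUnder ⟨_, this⟩

theorem tendsto_lowerQuasiAssouadDim (μ : Measure E) :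
    Tendsto (fun θ => lowerPhiDim (phiTheta θ) μ) (𝓝[<] (1 : ℝ)) (𝓝 (lowerQuasiAssouadDim μ)) := by
  have := (lowerPhiDim_anti μ).tendsto_nhdsWithin_Ioo_left
    (nonempty_Ioo.2 zero_lt_one) (OrderBot.bddBelow _)
  exact tendsto_nhds_limUnder ⟨_, this⟩

end Dimensions

/-! ### Similar copies, separation and the set-up -/

/-- The sets `J 0, …, J (t-1)` are subsets of `I`, each the image of `I` under a similarity of
ratio `r` (so that `diam (J i) = r * diam I`), and they are `τ`-separated: the distance between two
of them is at least `τ * r * diam I`. -/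
structure IsSeparatedFamily {E : Type*} [PseudoMetricSpace E] (t : ℕ) (r τ : ℝ) (I : Set E)
    (J : Fin t → Set E) : Prop where
  subset : ∀ i, J i ⊆ I
  similar : ∀ i, ∃ S : E → E, (∀ x y, dist (S x) (S y) = r * dist x y) ∧ J i = S '' I
  separated : ∀ i j, i ≠ j → ∀ x ∈ J i, ∀ y ∈ J j, τ * r * Metric.diam I ≤ dist x y

/-- The fixed data of the construction in `ℝ ^ D`: a compact set `I₀` of diameter `1` with non-empty
interior, `0 < τ < 1`, and for each `t` a number `r_t ∈ (0, 1/2]` such that `I₀` has the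
`(t, r, τ)`-separation property for all `0 < r ≤ r_t`. -/
structure Setup (D : ℕ) where
  I₀ : Set (EuclideanSpace ℝ (Fin D))
  isCompact : IsCompact I₀
  diam_eq : Metric.diam I₀ = 1
  interior_nonempty : (interior I₀).Nonempty
  τ : ℝ
  τ_pos : 0 < τ
  τ_lt_one : τ < 1
  rmax : ℕ → ℝ
  rmax_pos : ∀ t, 2 ≤ t → 0 < rmax t
  rmax_le : ∀ t, 2 ≤ t → rmax t ≤ 1 / 2
  separation : ∀ t, 2 ≤ t → ∀ r, 0 < r → r ≤ rmax t → ∃ J, IsSeparatedFamily t r τ I₀ J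

/-- The open probability simplex `𝒮_t`. -/
abbrev Simplex (t : ℕ) : Type := {p : Fin t → ℝ // (∀ i, 0 < p i) ∧ ∑ i, p i = 1}

/-- The space `Ω₀ = ⋃_{t ≥ 2} (0, r_t] × 𝒮_t` (a disjoint union), with its Borel `σ`-algebra. -/
abbrev Omega₀ {D : ℕ} (S : Setup D) : Type :=
  Σ t : {t : ℕ // 2 ≤ t}, Ioc (0 : ℝ) (S.rmax t) × Simplex t

/-- The sequence space `Ω = Ω₀ ^ ℕ`. The entry `ω n` is the `(n+1)`-st sample; it governs the passage
from the Moran sets of step `n` to those of step `n + 1`. -/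
abbrev Omega {D : ℕ} (S : Setup D) : Type := ℕ → Omega₀ S

section Random

variable {D : ℕ} {S : Setup D}

/-- The number of children `T`. -/
def numChildren (a : Omega₀ S) : ℕ := a.1

/-- The contraction ratio `r`. -/
def ratio (a : Omega₀ S) : ℝ := a.2.1

/-- The probability vector `p`. -/
def prob (a : Omega₀ S) : Fin (numChildren a) → ℝ := a.2.2.1

/-- `X n = -log (max_j p_{n+1}^{(j)})`. -/
def X (n : ℕ) (ω : Omega S) : ℝ := -Real.log (⨆ j, prob (ω n) j)

/-- `Y n = -log (min_j p_{n+1}^{(j)})`. -/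
def Y (n : ℕ) (ω : Omega S) : ℝ := -Real.log (⨅ j, prob (ω n) j)

/-- `Z n = -log r_{n+1}`. -/
def Z (n : ℕ) (ω : Omega S) : ℝ := -Real.log (ratio (ω n))

/-- The law `ℙ` on `Ω` of an iid sequence with distribution `π` on `Ω₀`. -/
def law (π : Measure (Omega₀ S)) : Measure (Omega S) := Measure.infinitePi (fun _ : ℕ => π)

/-- `W` has finite exponential moments near `0`: there is `A > 0` such that `𝔼(exp(l W)) < ∞`
for all `|l| ≤ A`. -/
def HasExpMomentsNearZero {Ω : Type*} [MeasurableSpace Ω] (P : Measure Ω) (W : Ω → ℝ) : Prop :=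
  ∃ A : ℝ, 0 < A ∧ ∀ l : ℝ, |l| ≤ A → Integrable (fun ω => Real.exp (l * W ω)) P

/-! ### Moran sets and Moran measures -/

/-- The labels of the Moran sets of step `n`: words `(j₁, …, j_n)` with `j_k` one of the
`T_k` labels of children. -/
inductive Word (ω : Omega S) : ℕ → Type
  | nil : Word ω 0
  | snoc {n : ℕ} (w : Word ω n) (j : Fin (numChildren (ω n))) : Word ω (n + 1)

/-- A realization of the Moran construction for `ω`: starting with `I₀`, each Moran set `I` of step
`n` has as its children `T_{n+1}` subsets of it that are `r_{n+1}`-similarities of `I` and are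
`τ`-separated. The choice of the children is arbitrary. -/
structure MoranFamily (ω : Omega S) where
  set : (n : ℕ) → Word ω n → Set (EuclideanSpace ℝ (Fin D))
  root : set 0 .nil = S.I₀
  children : ∀ (n : ℕ) (w : Word ω n),
    IsSeparatedFamily (numChildren (ω n)) (ratio (ω n)) S.τ (set n w)
      (fun j => set (n + 1) (w.snoc j))

/-- The defining rule of the Moran measure: it is a Borel probability measure with `μ(I₀) = 1` and
`μ(I^{(j)}) = μ(I) p_{n+1}^{(j)}` for the `j`-th child of a Moran set `I` of step `n`. -/
structure IsMoranMeasure {ω : Omega S} (F : MoranFamily ω)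
    (μ : Measure (EuclideanSpace ℝ (Fin D))) : Prop where
  isProbabilityMeasure : IsProbabilityMeasure μ
  root : μ S.I₀ = 1
  child : ∀ (n : ℕ) (w : Word ω n) (j : Fin (numChildren (ω n))),
    μ (F.set (n + 1) (w.snoc j)) = μ (F.set n w) * ENNReal.ofReal (prob (ω n) j)

theorem two_le_numChildren (a : Omega₀ S) : 2 ≤ numChildren a := a.1.2

theorem ratio_pos (a : Omega₀ S) : 0 < ratio a := a.2.1.2.1

theorem ratio_le_rmax (a : Omega₀ S) : ratio a ≤ S.rmax (numChildren a) := a.2.1.2.2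

theorem ratio_le (a : Omega₀ S) : ratio a ≤ 1 / 2 :=
  (ratio_le_rmax a).trans (S.rmax_le _ (two_le_numChildren a))

theorem prob_pos (a : Omega₀ S) (j) : 0 < prob a j := a.2.2.2.1 j

theorem sum_prob (a : Omega₀ S) : ∑ j, prob a j = 1 := a.2.2.2.2

theorem I₀_nonempty (S : Setup D) : S.I₀.Nonempty := S.interior_nonempty.mono interior_subset

instance instNonemptyFin (a : Omega₀ S) : Nonempty (Fin (numChildren a)) :=
  ⟨⟨0, by have := two_le_numChildren a; omega⟩⟩

/-- A word of length `n + 1` is a word of length `n` followed by a letter. -/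
def Word.equivProd (ω : Omega S) (n : ℕ) :
    Word ω n × Fin (numChildren (ω n)) ≃ Word ω (n + 1) where
  toFun p := p.1.snoc p.2
  invFun | .snoc w j => (w, j)
  left_inv _ := rfl
  right_inv w := by cases w; rfl

theorem Word.equivProd_apply (ω : Omega S) (n : ℕ) (w : Word ω n) (j) :
    Word.equivProd ω n (w, j) = w.snoc j := rfl

instance Word.instFintype (ω : Omega S) : (n : ℕ) → Fintype (Word ω n)
  | 0 => ⟨{.nil}, fun w => by cases w; simp⟩
  | n + 1 =>
    have := Word.instFintype ω n
    Fintype.ofEquiv (Word ω n × Fin (numChildren (ω n))) (Word.equivProd ω n)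

theorem bijective_of_dist {c : ℝ} (hc : 0 < c)
    {f : EuclideanSpace ℝ (Fin D) → EuclideanSpace ℝ (Fin D)}
    (hf : ∀ x y, dist (f x) (f y) = c * dist x y) :
    Function.Bijective f := by
  have hiso : Isometry (fun x => c⁻¹ • f x) := by
    apply Isometry.of_dist_eq
    intro x y
    rw [dist_smul₀, hf, Real.norm_eq_abs, abs_of_pos (inv_pos.2 hc)]
    field_simp
  constructor
  · intro x y h
    have := hf x y
    rw [h, dist_self] at this
    exact dist_eq_zero.1 (by nlinarith [dist_nonneg (x := x) (y := y)])
  · intro y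
    have hsurj : Function.Surjective (hiso.affineIsometryOfStrictConvexSpace) :=
      (hiso.affineIsometryOfStrictConvexSpace.toAffineIsometryEquiv rfl).surjective
    obtain ⟨x, hx⟩ := hsurj (c⁻¹ • y)
    refine ⟨x, ?_⟩
    have hx' : c⁻¹ • f x = c⁻¹ • y := hx
    exact smul_right_injective _ (inv_ne_zero hc.ne') hx'

/-- The similarity selected for a Moran set in the realization that repeats, at every Moran set of
step `n`, the same choice `s n` of similarities for the children. -/
def stdMap (ω : Omega S)
    (s : (n : ℕ) → Fin (numChildren (ω n)) → EuclideanSpace ℝ (Fin D) → EuclideanSpace ℝ (Fin D)) :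
    (n : ℕ) → Word ω n → EuclideanSpace ℝ (Fin D) → EuclideanSpace ℝ (Fin D)
  | 0, .nil => id
  | n + 1, .snoc w j => stdMap ω s n w ∘ s n j

theorem diam_image_of_dist {c : ℝ} (hc : 0 < c) {I : Set (EuclideanSpace ℝ (Fin D))}
    (hI : Bornology.IsBounded I) {f : EuclideanSpace ℝ (Fin D) → EuclideanSpace ℝ (Fin D)}
    (hf : ∀ x y, dist (f x) (f y) = c * dist x y) :
    Metric.diam (f '' I) = c * Metric.diam I := by
  have hle : ∀ a ∈ f '' I, ∀ b ∈ f '' I, dist a b ≤ c * Metric.diam I := by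
    rintro _ ⟨x, hx, rfl⟩ _ ⟨y, hy, rfl⟩
    rw [hf]
    exact mul_le_mul_of_nonneg_left (Metric.dist_le_diam_of_mem hI hx hy) hc.le
  have hb : Bornology.IsBounded (f '' I) := Metric.isBounded_iff.2 ⟨_, fun a ha b hb => hle a ha b hb⟩
  apply le_antisymm (Metric.diam_le_of_forall_dist_le (mul_nonneg hc.le Metric.diam_nonneg) hle)
  have h2 : Metric.diam I ≤ Metric.diam (f '' I) / c := by
    apply Metric.diam_le_of_forall_dist_le (div_nonneg Metric.diam_nonneg hc.le)
    intro x hx y hy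
    rw [le_div_iff₀ hc]
    have := Metric.dist_le_diam_of_mem hb (mem_image_of_mem f hx) (mem_image_of_mem f hy)
    rw [hf] at this
    linarith
  rw [le_div_iff₀ hc] at h2
  linarith

/-- The Moran construction can be carried out for every `ω`. -/
theorem nonempty_moranFamily (ω : Omega S) : Nonempty (MoranFamily ω) := by
  choose J hJ using fun n => S.separation _ (two_le_numChildren (ω n)) _ (ratio_pos (ω n))
    (ratio_le_rmax (ω n))
  choose s hs hsJ using fun n => (hJ n).similar
  have hdist : ∀ n, ∃ c : ℝ, 0 < c ∧ ∀ w x y,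
      dist (stdMap ω s n w x) (stdMap ω s n w y) = c * dist x y := by
    intro n
    induction n with
    | zero => exact ⟨1, one_pos, fun w x y => by cases w; simp [stdMap]⟩
    | succ n ih =>
      obtain ⟨c, hc, h⟩ := ih
      refine ⟨c * ratio (ω n), mul_pos hc (ratio_pos _), fun w x y => ?_⟩
      obtain _ | ⟨w, j⟩ := w
      simp only [stdMap, Function.comp_apply]
      rw [h, hs]
      ring
  refine ⟨⟨fun n w => stdMap ω s n w '' S.I₀, by simp [stdMap], fun n w => ?_⟩⟩
  obtain ⟨c, hc, h⟩ := hdist n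
  have hset : ∀ j, stdMap ω s (n + 1) (w.snoc j) '' S.I₀ = stdMap ω s n w '' J n j := by
    intro j
    rw [hsJ, ← image_comp]
    rfl
  have hdiam : Metric.diam (stdMap ω s n w '' S.I₀) = c := by
    rw [diam_image_of_dist hc S.isCompact.isBounded (h w), S.diam_eq, mul_one]
  obtain ⟨g, hg1, hg2⟩ := Function.bijective_iff_has_inverse.1 (bijective_of_dist hc (h w))
  have hg : ∀ x y, c * dist (g x) (g y) = dist x y := by
    intro x y
    rw [← h w, hg2, hg2]
  constructor
  · intro j
    rw [hset]
    exact image_mono ((hJ n).subset j)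
  · intro j
    refine ⟨stdMap ω s n w ∘ s n j ∘ g, fun x y => ?_, ?_⟩
    · simp only [Function.comp_apply]
      rw [h, hs, ← hg x y]
      ring
    · rw [hset, hsJ, ← image_comp, ← image_comp]
      congr 1
      funext x
      simp [hg1 x]
  · intro i j hij x hx y hy
    rw [hset] at hx hy
    obtain ⟨x, hx, rfl⟩ := hx
    obtain ⟨y, hy, rfl⟩ := hy
    have := (hJ n).separated i j hij x hx y hy
    rw [S.diam_eq] at this
    rw [hdiam, h]
    nlinarith

namespace MoranFamily

variable {ω : Omega S} (F : MoranFamily ω)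

theorem set_basic (n : ℕ) (w : Word ω n) : IsCompact (F.set n w) ∧ (F.set n w).Nonempty ∧
    0 < Metric.diam (F.set n w) ∧ Metric.diam (F.set n w) ≤ (1 / 2) ^ n := by
  induction n with
  | zero =>
    cases w
    have := F.root
    refine ⟨?_, ?_, ?_, ?_⟩
    · rw [this]; exact S.isCompact
    · rw [this]; exact I₀_nonempty S
    · rw [this, S.diam_eq]; exact one_pos
    · rw [this, S.diam_eq]; simp
  | succ n ih =>
    obtain _ | ⟨w, j⟩ := w
    obtain ⟨h1, h2, h3, h4⟩ := ih w
    obtain ⟨f, hf, hfj⟩ := (F.children n w).similar j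
    have hr := ratio_pos (ω n)
    have hcont : Continuous f := by
      have : LipschitzWith (ratio (ω n)).toNNReal f := by
        apply LipschitzWith.of_dist_le_mul
        intro x y
        rw [hf, Real.coe_toNNReal _ hr.le]
      exact this.continuous
    have hd := diam_image_of_dist hr h1.isBounded hf
    refine ⟨?_, ?_, ?_, ?_⟩
    · rw [hfj]; exact h1.image hcont
    · rw [hfj]; exact h2.image _
    · rw [hfj, hd]; positivity
    · rw [hfj, hd, pow_succ]
      have := ratio_le (ω n)
      nlinarith

theorem disjoint_set (n : ℕ) (w v : Word ω n) (h : w ≠ v) : Disjoint (F.set n w) (F.set n v) := by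
  induction n with
  | zero => cases w; cases v; exact absurd rfl h
  | succ n ih =>
    obtain _ | ⟨w, j⟩ := w
    obtain _ | ⟨v, k⟩ := v
    by_cases hwv : w = v
    · subst hwv
      have hjk : j ≠ k := fun e => h (by rw [e])
      rw [Set.disjoint_left]
      intro x hx hy
      have := (F.children n w).separated j k hjk x hx x hy
      rw [dist_self] at this
      have h3 := (F.set_basic n w).2.2.1
      have := mul_pos (mul_pos S.τ_pos (ratio_pos (ω n))) h3
      linarith
    · exact (ih w v hwv).mono ((F.children n w).subset j) ((F.children n v).subset k)

/-- The word formed by the first `n` letters of an infinite address. -/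
def wordOf (i : (k : ℕ) → Fin (numChildren (ω k))) : (n : ℕ) → Word ω n
  | 0 => .nil
  | n + 1 => (wordOf i n).snoc (i n)

theorem wordOf_congr (i i' : (k : ℕ) → Fin (numChildren (ω k))) (n : ℕ) :
    wordOf i n = wordOf i' n ↔ ∀ k < n, i k = i' k := by
  induction n with
  | zero => simp [wordOf]
  | succ n ih =>
    simp only [wordOf, Word.snoc.injEq]
    rw [ih]
    constructor
    · rintro ⟨h1, h2⟩ k hk
      rcases Nat.lt_succ_iff_lt_or_eq.1 hk with h | rfl
      · exact h1 k h
      · exact h2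
    · intro h
      exact ⟨fun k hk => h k (by omega), h n (by omega)⟩

theorem exists_wordOf (n : ℕ) (w : Word ω n) : ∃ i, wordOf i n = w := by
  induction n with
  | zero => exact ⟨fun k => Classical.arbitrary _, by cases w; rfl⟩
  | succ n ih =>
    obtain _ | ⟨w, j⟩ := w
    obtain ⟨i, hi⟩ := ih w
    refine ⟨Function.update i n j, ?_⟩
    simp only [wordOf]
    rw [Function.update_self]
    congr 1
    rw [← hi, wordOf_congr]
    intro k hk
    rw [Function.update_of_ne (by omega)]

theorem exists_mem_all (i : (k : ℕ) → Fin (numChildren (ω k))) :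
    ∃ x, ∀ n, x ∈ F.set n (wordOf i n) := by
  have := IsCompact.nonempty_iInter_of_sequence_nonempty_isCompact_isClosed
    (fun n => F.set n (wordOf i n)) (fun n => (F.children n _).subset _)
    (fun n => (F.set_basic n _).2.1) (F.set_basic 0 _).1 (fun n => (F.set_basic n _).1.isClosed)
  obtain ⟨x, hx⟩ := this
  exact ⟨x, fun n => mem_iInter.1 hx n⟩

/-- The point of the Moran set with a given address. -/
def code (i : (k : ℕ) → Fin (numChildren (ω k))) : EuclideanSpace ℝ (Fin D) :=
  (F.exists_mem_all i).choose

theorem code_mem (i : (k : ℕ) → Fin (numChildren (ω k))) (n : ℕ) :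
    F.code i ∈ F.set n (wordOf i n) :=
  (F.exists_mem_all i).choose_spec n

theorem code_mem_iff (i : (k : ℕ) → Fin (numChildren (ω k))) (n : ℕ) (w : Word ω n) :
    F.code i ∈ F.set n w ↔ wordOf i n = w := by
  constructor
  · intro h
    by_contra hne
    exact Set.disjoint_left.1 (F.disjoint_set n _ _ hne) (F.code_mem i n) h
  · rintro rfl
    exact F.code_mem i n

theorem continuous_code : Continuous F.code := by
  rw [continuous_iff_continuousAt]
  intro i
  rw [ContinuousAt, Metric.tendsto_nhds]
  intro ε hε
  obtain ⟨n, hn⟩ := exists_pow_lt_of_lt_one hε (show (1 / 2 : ℝ) < 1 by norm_num)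
  have hev : ∀ᶠ i' in 𝓝 i, ∀ k ∈ Finset.range n, i' k = i k := by
    rw [Filter.eventually_all_finset]
    intro k _
    have : ContinuousAt (fun i' : (k : ℕ) → Fin (numChildren (ω k)) => i' k) i :=
      (continuous_apply k).continuousAt
    exact this.eventually (by rw [nhds_discrete]; simp : ∀ᶠ j in 𝓝 (i k), j = i k)
  filter_upwards [hev] with i' hi'
  have hw : wordOf i' n = wordOf i n :=
    (wordOf_congr i' i n).2 fun k hk => hi' k (Finset.mem_range.2 hk)
  have h1 := F.code_mem i' n
  rw [hw] at h1
  have hb := F.set_basic n (wordOf i n)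
  exact ((Metric.dist_le_diam_of_mem hb.1.isBounded h1 (F.code_mem i n)).trans hb.2.2.2).trans_lt hn

end MoranFamily

/-- The distribution of the label of a child. -/
def letterLaw (a : Omega₀ S) : Measure (Fin (numChildren a)) :=
  ∑ j, ENNReal.ofReal (prob a j) • Measure.dirac j

theorem letterLaw_singleton (a : Omega₀ S) (j) :
    letterLaw a {j} = ENNReal.ofReal (prob a j) := by
  simp only [letterLaw, Measure.finsetSum_apply, Measure.smul_apply, smul_eq_mul]
  rw [Finset.sum_eq_single j]
  · simp
  · intro k _ hk
    simp [hk]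
  · simp

instance instProbLetterLaw (a : Omega₀ S) : IsProbabilityMeasure (letterLaw a) := by
  constructor
  simp only [letterLaw, Measure.finsetSum_apply, Measure.smul_apply, smul_eq_mul, measure_univ,
    mul_one]
  rw [← ENNReal.ofReal_sum_of_nonneg (fun j _ => (prob_pos a j).le), sum_prob, ENNReal.ofReal_one]

theorem exists_isMoranMeasure {ω : Omega S} (F : MoranFamily ω) : ∃ μ, IsMoranMeasure F μ := by
  have hm : Measurable F.code := F.continuous_code.measurable
  have hms : ∀ n w, MeasurableSet (F.set n w) := fun n w => (F.set_basic n w).1.measurableSet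
  let ν := Measure.infinitePi (fun k : ℕ => letterLaw (ω k))
  have hν : ∀ n (i : (k : ℕ) → Fin (numChildren (ω k))),
      (ν.map F.code) (F.set n (MoranFamily.wordOf i n)) =
        ∏ k ∈ Finset.range n, ENNReal.ofReal (prob (ω k) (i k)) := by
    intro n i
    rw [Measure.map_apply hm (hms _ _)]
    have : F.code ⁻¹' (F.set n (MoranFamily.wordOf i n)) =
        Set.pi (Finset.range n) (fun k => {i k}) := by
      ext i'
      simp only [mem_preimage, F.code_mem_iff, MoranFamily.wordOf_congr]
      simp
    rw [this, Measure.infinitePi_pi _ (fun k _ => MeasurableSet.singleton _)]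
    exact Finset.prod_congr rfl fun k _ => letterLaw_singleton _ _
  refine ⟨ν.map F.code, Measure.isProbabilityMeasure_map hm.aemeasurable, ?_, fun n w j => ?_⟩
  · have := hν 0 (fun k => Classical.arbitrary _)
    simpa [MoranFamily.wordOf, F.root] using this
  · obtain ⟨i, hi⟩ := MoranFamily.exists_wordOf (n + 1) (w.snoc j)
    have h1 := hν (n + 1) i
    have h2 := hν n i
    rw [hi, Finset.prod_range_succ, ← h2] at h1
    simp only [MoranFamily.wordOf, Word.snoc.injEq] at hi
    obtain ⟨rfl, rfl⟩ := hi
    exact h1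

theorem IsMoranMeasure.measure_biUnion {ω : Omega S} {F : MoranFamily ω}
    {μ : Measure (EuclideanSpace ℝ (Fin D))} (n : ℕ) (s : Finset (Word ω n)) :
    μ (⋃ w ∈ s, F.set n w) = ∑ w ∈ s, μ (F.set n w) :=
  measure_biUnion_finset (fun w _ v _ h => F.disjoint_set n w v h)
    (fun w _ => (F.set_basic n w).1.measurableSet)

theorem IsMoranMeasure.sum_eq_one {ω : Omega S} {F : MoranFamily ω}
    {μ : Measure (EuclideanSpace ℝ (Fin D))} (h : IsMoranMeasure F μ) (n : ℕ) :
    ∑ w, μ (F.set n w) = 1 := by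
  induction n with
  | zero =>
    have hu : (Finset.univ : Finset (Word ω 0)) = {.nil} := rfl
    rw [hu, Finset.sum_singleton, F.root, h.root]
  | succ n ih =>
    rw [← (Word.equivProd ω n).sum_comp, Fintype.sum_prod_type]
    simp only [Word.equivProd_apply, h.child]
    rw [← ih]
    refine Finset.sum_congr rfl fun w _ => ?_
    rw [← Finset.mul_sum, ← ENNReal.ofReal_sum_of_nonneg (fun j _ => (prob_pos _ j).le),
      sum_prob, ENNReal.ofReal_one, mul_one]

theorem IsMoranMeasure.eq_set {ω : Omega S} {F : MoranFamily ω}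
    {μ ν : Measure (EuclideanSpace ℝ (Fin D))} (hμ : IsMoranMeasure F μ) (hν : IsMoranMeasure F ν)
    (n : ℕ) (w : Word ω n) : μ (F.set n w) = ν (F.set n w) := by
  induction n with
  | zero =>
    cases w
    rw [F.root, hμ.root, hν.root]
  | succ n ih =>
    obtain _ | ⟨w, j⟩ := w
    rw [hμ.child, hν.child, ih]

theorem IsMoranMeasure.le_closed {ω : Omega S} {F : MoranFamily ω}
    {μ ν : Measure (EuclideanSpace ℝ (Fin D))} (hμ : IsMoranMeasure F μ) (hν : IsMoranMeasure F ν)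
    {K : Set (EuclideanSpace ℝ (Fin D))} (hK : IsClosed K) : μ K ≤ ν K := by
  classical
  have := hμ.isProbabilityMeasure
  have := hν.isProbabilityMeasure
  have hlim : Tendsto (fun n : ℕ => ν (Metric.cthickening ((1 / 2 : ℝ) ^ n) K)) atTop (𝓝 (ν K)) :=
    (tendsto_measure_cthickening_of_isClosed ⟨1, one_pos, measure_ne_top _ _⟩ hK).comp
      (tendsto_pow_atTop_nhds_zero_of_lt_one (by norm_num) (by norm_num))
  refine ge_of_tendsto' hlim fun n => ?_
  let s : Finset (Word ω n) := Finset.univ.filter fun w => (F.set n w ∩ K).Nonempty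
  have hfull : μ (⋃ w ∈ (Finset.univ : Finset (Word ω n)), F.set n w)ᶜ = 0 := by
    have hms : MeasurableSet (⋃ w ∈ (Finset.univ : Finset (Word ω n)), F.set n w) :=
      Finset.measurableSet_biUnion _ fun w _ => (F.set_basic n w).1.measurableSet
    rw [prob_compl_eq_zero_iff hms, IsMoranMeasure.measure_biUnion, hμ.sum_eq_one]
  calc μ K ≤ μ ((⋃ w ∈ s, F.set n w) ∪
        (⋃ w ∈ (Finset.univ : Finset (Word ω n)), F.set n w)ᶜ) := by
        apply measure_mono
        intro x hx
        by_cases h : x ∈ ⋃ w ∈ (Finset.univ : Finset (Word ω n)), F.set n w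
        · left
          simp only [Finset.mem_univ, iUnion_true, mem_iUnion] at h
          obtain ⟨w, hw⟩ := h
          simp only [mem_iUnion]
          exact ⟨w, Finset.mem_filter.2 ⟨Finset.mem_univ _, x, hw, hx⟩, hw⟩
        · right
          exact h
    _ ≤ μ (⋃ w ∈ s, F.set n w) + 0 := by
        rw [← hfull]
        exact measure_union_le _ _
    _ = ν (⋃ w ∈ s, F.set n w) := by
        rw [add_zero, IsMoranMeasure.measure_biUnion, IsMoranMeasure.measure_biUnion]
        exact Finset.sum_congr rfl fun w _ => hμ.eq_set hν n w
    _ ≤ ν (Metric.cthickening ((1 / 2 : ℝ) ^ n) K) := by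
        apply measure_mono
        intro x hx
        simp only [mem_iUnion] at hx
        obtain ⟨w, hw, hx⟩ := hx
        obtain ⟨y, hy, hyK⟩ := (Finset.mem_filter.1 hw).2
        have hb := F.set_basic n w
        exact Metric.mem_cthickening_of_dist_le x y _ K hyK
          ((Metric.dist_le_diam_of_mem hb.1.isBounded hx hy).trans hb.2.2.2)

/-- The mass rule determines a unique Borel probability measure. -/
theorem existsUnique_isMoranMeasure {ω : Omega S} (F : MoranFamily ω) :
    ∃! μ, IsMoranMeasure F μ := by
  obtain ⟨μ, hμ⟩ := exists_isMoranMeasure F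
  refine ⟨μ, hμ, fun ν hν => ?_⟩
  have := hμ.isProbabilityMeasure
  have := hν.isProbabilityMeasure
  refine ext_of_generate_finite _ ?_ isPiSystem_isClosed (fun A hA => ?_) (by simp)
  · rw [BorelSpace.measurable_eq (α := EuclideanSpace ℝ (Fin D)), borel_eq_generateFrom_isClosed]
  · exact le_antisymm (hν.le_closed hμ hA) (hμ.le_closed hν hA)

/-- The Moran measure `μ_ω` of a realization of the Moran construction for `ω`: the unique Borel
probability measure obeying the mass rule `IsMoranMeasure`. -/
def moranMeasure {ω : Omega S} (F : MoranFamily ω) : Measure (EuclideanSpace ℝ (Fin D)) :=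
  (existsUnique_isMoranMeasure F).choose

theorem isMoranMeasure_moranMeasure {ω : Omega S} (F : MoranFamily ω) :
    IsMoranMeasure F (moranMeasure F) :=
  (existsUnique_isMoranMeasure F).choose_spec.1

end Random

end

end RandomMoran

open RandomMoran

namespace RandomMoran

open ProbabilityTheory

variable {D : ℕ} {S : Setup D}

/-! ### Strong laws of large numbers -/

/-! By the strong law of large numbers, off a null set the averages of `X`, `Y` and `Z` converge to
their means. The rest is deterministic and uses only this convergence, so one null set serves every
choice of the Moran sets.

All Moran sets of step n have the same diameter `scale ω n`, and τ-separation pinches a ball of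
radius R centred in the support between two Moran sets around its centre whose diameters match R up
to a factor τ and one step (`real_ball_le`, `le_real_ball`). Along any address the k-th step costs
between X_k and Y_k in logarithmic mass. Since the sums of X, Y and Z grow linearly, the increment
of log μ(B(x,·)) from r to R is at least (E X/E Z) log(R/r) and at most (E Y/E Z) log(R/r), up to an
error ε(|log R| + |log r|) + K that is uniform on the support (`le_log_real_ball_sub`,
`log_real_ball_sub_le`).

If r < R^(1/θ), then log(R/r) dominates (1-θ)|log r|, so the error is absorbed by an arbitrarily
small change of the exponent. The Frostman and Minkowski bounds are the case R = 1. For sharpness,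
the point that always follows a heaviest child loses exactly X_k at each step, and the one that
follows a lightest child loses Y_k. With R fixed, an admissible exponent is a power bound on small
balls, which is tested at these points (`le_of_forall_real_ball_le`, `le_of_forall_le_real_ball`).
Hence the θ-dimensions do not depend on θ, and their limits are immediate. -/

theorem measurable_of_comp_sigmaMk {α γ : Type*} {β : α → Type*} [∀ a, MeasurableSpace (β a)]
    [MeasurableSpace γ] {f : Sigma β → γ} (hf : ∀ a, Measurable fun b => f ⟨a, b⟩) :
    Measurable f :=
  fun _ hs => MeasurableSpace.measurableSet_iInf.2 fun a => hf a hs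

theorem measurable_ratio : Measurable (ratio : Omega₀ S → ℝ) :=
  measurable_of_comp_sigmaMk fun t =>
    show Measurable fun p : Ioc (0 : ℝ) (S.rmax t) × Simplex t => (p.1 : ℝ) by fun_prop

theorem measurable_iSup_prob : Measurable (fun a : Omega₀ S => ⨆ j, prob a j) :=
  measurable_of_comp_sigmaMk fun t =>
    show Measurable fun p : Ioc (0 : ℝ) (S.rmax t) × Simplex t => ⨆ j, (p.2.1 j : ℝ) from
      Measurable.iSup fun j => (measurable_pi_apply j).comp (measurable_subtype_coe.comp measurable_snd)

theorem measurable_iInf_prob : Measurable (fun a : Omega₀ S => ⨅ j, prob a j) :=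
  measurable_of_comp_sigmaMk fun t =>
    show Measurable fun p : Ioc (0 : ℝ) (S.rmax t) × Simplex t => ⨅ j, (p.2.1 j : ℝ) from
      Measurable.iInf fun j => (measurable_pi_apply j).comp (measurable_subtype_coe.comp measurable_snd)

/-- Zero is interior to the set where the moment generating function is finite, which gives all
moments, in particular the first. -/
theorem HasExpMomentsNearZero.integrable {Ω : Type*} [MeasurableSpace Ω] {P : Measure Ω}
    {W : Ω → ℝ} (h : HasExpMomentsNearZero P W) : Integrable W P := by
  obtain ⟨A, hA, h⟩ := h
  refine integrable_of_mem_interior_integrableExpSet (mem_interior.2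
    ⟨Ioo (-A) A, fun l hl => h l (abs_le.2 ⟨hl.1.le, hl.2.le⟩), isOpen_Ioo, by simpa using hA⟩)

theorem ae_tendsto_average (π : Measure (Omega₀ S)) [IsProbabilityMeasure π] {f : Omega₀ S → ℝ}
    (hf : Measurable f) (hint : Integrable (fun ω : Omega S => f (ω 0)) (law π)) :
    ∀ᵐ ω ∂(law π), Tendsto (fun n : ℕ => (∑ k ∈ Finset.range n, f (ω k)) / n) atTop
      (𝓝 (∫ η, f (η 0) ∂(law π))) := by
  refine strong_law_ae_real (fun n (ω : Omega S) => f (ω n)) hint ?_ fun n => ?_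
  · intro m n hmn
    exact (iIndepFun_infinitePi (P := fun _ : ℕ => π) (X := fun _ => f) fun _ => hf).indepFun hmn
  · have h (n : ℕ) : (law π).map (fun ω : Omega S => f (ω n)) = π.map f := by
      have := Measure.map_map (μ := law π) hf (measurable_pi_apply n)
      rw [law, (measurePreserving_eval_infinitePi (fun _ : ℕ => π) n).map_eq] at this
      exact this.symm
    exact ⟨(hf.comp (measurable_pi_apply n)).aemeasurable,
      (hf.comp (measurable_pi_apply 0)).aemeasurable, by rw [h, h]⟩

/-! ### Geometry of the Moran sets -/

/-- The diameter of the Moran sets of step `n`. -/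
noncomputable def scale (ω : Omega S) (n : ℕ) : ℝ := ∏ k ∈ Finset.range n, ratio (ω k)

theorem scale_pos (ω : Omega S) (n : ℕ) : 0 < scale ω n :=
  Finset.prod_pos fun _ _ => ratio_pos _

theorem scale_succ (ω : Omega S) (n : ℕ) : scale ω (n + 1) = scale ω n * ratio (ω n) :=
  Finset.prod_range_succ _ _

theorem scale_succ_le (ω : Omega S) (n : ℕ) : scale ω (n + 1) ≤ scale ω n * (1 / 2) := by
  rw [scale_succ]
  exact mul_le_mul_of_nonneg_left (ratio_le _) (scale_pos ω n).le

theorem scale_le (ω : Omega S) (n : ℕ) : scale ω n ≤ (1 / 2) ^ n := by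
  induction n with
  | zero => simp [scale]
  | succ n ih =>
    rw [pow_succ]
    exact (scale_succ_le ω n).trans (by linarith)

theorem tendsto_scale (ω : Omega S) : Tendsto (scale ω) atTop (𝓝 0) :=
  squeeze_zero (fun n => (scale_pos ω n).le) (scale_le ω)
    (tendsto_pow_atTop_nhds_zero_of_lt_one (by norm_num) (by norm_num))

theorem log_scale (ω : Omega S) (n : ℕ) :
    Real.log (scale ω n) = -∑ k ∈ Finset.range n, Z k ω := by
  rw [scale, Real.log_prod fun k _ => (ratio_pos (ω k)).ne', ← Finset.sum_neg_distrib]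
  simp [Z]

namespace MoranFamily

variable {ω : Omega S} (F : MoranFamily ω)

theorem diam_set (n : ℕ) (w : Word ω n) : Metric.diam (F.set n w) = scale ω n := by
  induction n with
  | zero =>
    cases w
    rw [F.root, S.diam_eq]
    simp [scale]
  | succ n ih =>
    obtain _ | ⟨w, j⟩ := w
    obtain ⟨f, hf, hfj⟩ := (F.children n w).similar j
    rw [hfj, diam_image_of_dist (ratio_pos (ω n)) (F.set_basic n w).1.isBounded hf, ih, scale_succ,
      mul_comm]

/-- Two distinct words first differ at some step m ≤ n, where separation gives a distance of at
least τ times the scale of step m; scales decrease, so passing to descendants only weakens the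
bound. -/
theorem scale_le_dist {n : ℕ} {w v : Word ω n} (h : w ≠ v) {x y : EuclideanSpace ℝ (Fin D)}
    (hx : x ∈ F.set n w) (hy : y ∈ F.set n v) : S.τ * scale ω n ≤ dist x y := by
  induction n with
  | zero => cases w; cases v; exact absurd rfl h
  | succ n ih =>
    obtain _ | ⟨w, j⟩ := w
    obtain _ | ⟨v, k⟩ := v
    by_cases hwv : w = v
    · subst hwv
      have := (F.children n w).separated j k (fun e => h (by rw [e])) x hx y hy
      rw [F.diam_set] at this
      rw [scale_succ]
      linarith
    · have h1 := ih hwv ((F.children n w).subset j hx) ((F.children n v).subset k hy)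
      have h2 := scale_succ_le ω n
      have h3 := scale_pos ω n
      exact (mul_le_mul_of_nonneg_left (by linarith) S.τ_pos.le).trans h1

/-- Sets of one step are disjoint and children are nested, so the words of the sets containing x
extend one another and form a single address. -/
theorem exists_wordOf_mem {x : EuclideanSpace ℝ (Fin D)} (h : ∀ n, ∃ w, x ∈ F.set n w) :
    ∃ i, ∀ n, x ∈ F.set n (wordOf i n) := by
  choose w hw using h
  have hj : ∀ n, ∃ j, w (n + 1) = (w n).snoc j := by
    intro n
    have h1 := hw (n + 1)
    generalize w (n + 1) = v at h1
    obtain _ | ⟨v, j⟩ := v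
    have hv : v = w n := by
      by_contra hne
      exact Set.disjoint_left.1 (F.disjoint_set n _ _ hne) ((F.children n v).subset j h1) (hw n)
    exact ⟨j, by rw [hv]⟩
  choose i hi using hj
  refine ⟨i, fun n => ?_⟩
  have : wordOf i n = w n := by
    induction n with
    | zero => cases w 0; rfl
    | succ n ih => rw [hi, ← ih]; rfl
  rw [this]
  exact hw n

end MoranFamily

/-! ### Balls compared with Moran sets -/

namespace IsMoranMeasure

variable {ω : Omega S} {F : MoranFamily ω} {μ : Measure (EuclideanSpace ℝ (Fin D))}

theorem measure_compl_iUnion (h : IsMoranMeasure F μ) (n : ℕ) :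
    μ (⋃ w ∈ (Finset.univ : Finset (Word ω n)), F.set n w)ᶜ = 0 := by
  have := h.isProbabilityMeasure
  rw [prob_compl_eq_zero_iff
    (Finset.measurableSet_biUnion _ fun w _ => (F.set_basic n w).1.measurableSet),
    IsMoranMeasure.measure_biUnion, h.sum_eq_one]

theorem exists_address (h : IsMoranMeasure F μ) {x : EuclideanSpace ℝ (Fin D)}
    (hx : x ∈ μ.support) : ∃ i, ∀ n, x ∈ F.set n (MoranFamily.wordOf i n) := by
  refine F.exists_wordOf_mem fun n => ?_
  -- A finite union of compact sets is closed and here has full measure, so it contains the support.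
  have hcl : IsClosed (⋃ w ∈ (Finset.univ : Finset (Word ω n)), F.set n w) :=
    isClosed_biUnion_finset fun w _ => (F.set_basic n w).1.isClosed
  have := Measure.support_subset_of_isClosed hcl (h.measure_compl_iUnion n) hx
  simpa using this

theorem real_set (h : IsMoranMeasure F μ) (i : (k : ℕ) → Fin (numChildren (ω k))) (n : ℕ) :
    μ.real (F.set n (MoranFamily.wordOf i n)) = ∏ k ∈ Finset.range n, prob (ω k) (i k) := by
  induction n with
  | zero => simp [MoranFamily.wordOf, F.root, Measure.real, h.root]
  | succ n ih =>
    rw [Finset.prod_range_succ, ← ih, MoranFamily.wordOf, Measure.real, h.child,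
      ENNReal.toReal_mul, ENNReal.toReal_ofReal (prob_pos _ _).le]
    rfl

/-- The open ball is too small to reach any other Moran set of step n, and what lies outside all of
them is null. -/
theorem real_ball_le (h : IsMoranMeasure F μ) {x : EuclideanSpace ℝ (Fin D)} {n : ℕ}
    {w : Word ω n} (hx : x ∈ F.set n w) {R : ℝ} (hR : R ≤ S.τ * scale ω n) :
    μ.real (Metric.ball x R) ≤ μ.real (F.set n w) := by
  have := h.isProbabilityMeasure
  refine ENNReal.toReal_mono (measure_ne_top _ _) ?_
  calc μ (Metric.ball x R)
      ≤ μ (F.set n w ∪ (⋃ w ∈ (Finset.univ : Finset (Word ω n)), F.set n w)ᶜ) := by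
        apply measure_mono
        intro y hy
        by_cases hy' : y ∈ ⋃ w ∈ (Finset.univ : Finset (Word ω n)), F.set n w
        · left
          simp only [Finset.mem_univ, iUnion_true, mem_iUnion] at hy'
          obtain ⟨v, hv⟩ := hy'
          by_contra hne
          have hvw : v ≠ w := fun e => hne (e ▸ hv)
          have h1 := F.scale_le_dist hvw hv hx
          have h2 := Metric.mem_ball.1 hy
          linarith
        · exact Or.inr hy'
    _ ≤ μ (F.set n w) + 0 := by
        rw [← h.measure_compl_iUnion n]
        exact measure_union_le _ _
    _ = μ (F.set n w) := add_zero _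

theorem le_real_ball (h : IsMoranMeasure F μ) {x : EuclideanSpace ℝ (Fin D)} {n : ℕ}
    {w : Word ω n} (hx : x ∈ F.set n w) {R : ℝ} (hR : scale ω n < R) :
    μ.real (F.set n w) ≤ μ.real (Metric.ball x R) := by
  have := h.isProbabilityMeasure
  refine ENNReal.toReal_mono (measure_ne_top _ _) (measure_mono fun y hy => ?_)
  have := Metric.dist_le_diam_of_mem (F.set_basic n w).1.isBounded hy hx
  rw [F.diam_set] at this
  exact Metric.mem_ball.2 (this.trans_lt hR)

theorem code_mem_support (h : IsMoranMeasure F μ) (i : (k : ℕ) → Fin (numChildren (ω k))) :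
    F.code i ∈ μ.support := by
  refine (Metric.nhds_basis_ball.mem_measureSupport).2 fun R hR => ?_
  obtain ⟨n, hn⟩ := ((tendsto_scale ω).eventually_lt_const hR).exists
  have h1 := h.le_real_ball (F.code_mem i n) hn
  rw [h.real_set] at h1
  have h2 : 0 < ∏ k ∈ Finset.range n, prob (ω k) (i k) := Finset.prod_pos fun k _ => prob_pos _ _
  exact (ENNReal.toReal_pos_iff.1 (h2.trans_le h1)).1

end IsMoranMeasure

/-! ### Mass loss along an address -/

/-- The cumulative logarithmic loss of mass along an address. -/
noncomputable def logLoss {ω : Omega S} (i : (k : ℕ) → Fin (numChildren (ω k))) (n : ℕ) : ℝ :=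
  ∑ k ∈ Finset.range n, -Real.log (prob (ω k) (i k))

theorem exp_neg_logLoss {ω : Omega S} (i : (k : ℕ) → Fin (numChildren (ω k))) (n : ℕ) :
    Real.exp (-logLoss i n) = ∏ k ∈ Finset.range n, prob (ω k) (i k) := by
  rw [logLoss, Finset.sum_neg_distrib, neg_neg, Real.exp_sum]
  exact Finset.prod_congr rfl fun k _ => Real.exp_log (prob_pos _ _)

theorem X_le (ω : Omega S) (k : ℕ) (j : Fin (numChildren (ω k))) :
    X k ω ≤ -Real.log (prob (ω k) j) :=
  neg_le_neg (Real.log_le_log (prob_pos _ _) (le_ciSup (Finite.bddAbove_range _) j))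

theorem le_Y (ω : Omega S) (k : ℕ) (j : Fin (numChildren (ω k))) :
    -Real.log (prob (ω k) j) ≤ Y k ω := by
  obtain ⟨j', hj'⟩ := exists_eq_ciInf_of_finite (f := prob (ω k))
  refine neg_le_neg (Real.log_le_log ?_ (ciInf_le (Finite.bddBelow_range _) j))
  rw [← hj']
  exact prob_pos _ _

/-- The address of a heaviest child at every step; its point witnesses sharpness of the bounds by
`X`. -/
theorem exists_logLoss_eq_X (ω : Omega S) :
    ∃ i : (k : ℕ) → Fin (numChildren (ω k)), ∀ n, logLoss i n = ∑ k ∈ Finset.range n, X k ω := by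
  choose i hi using fun k => exists_eq_ciSup_of_finite (f := prob (ω k))
  exact ⟨i, fun n => by simp only [logLoss, X, hi]⟩

theorem exists_logLoss_eq_Y (ω : Omega S) :
    ∃ i : (k : ℕ) → Fin (numChildren (ω k)), ∀ n, logLoss i n = ∑ k ∈ Finset.range n, Y k ω := by
  choose i hi using fun k => exists_eq_ciInf_of_finite (f := prob (ω k))
  exact ⟨i, fun n => by simp only [logLoss, Y, hi]⟩

theorem prob_le_one (a : Omega₀ S) (j) : prob a j ≤ 1 := by
  rw [← sum_prob a]
  exact Finset.single_le_sum (fun j _ => (prob_pos a j).le) (Finset.mem_univ j)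

theorem X_nonneg (ω : Omega S) (k : ℕ) : 0 ≤ X k ω := by
  obtain ⟨j, hj⟩ := exists_eq_ciSup_of_finite (f := prob (ω k))
  rw [X, ← hj]
  exact neg_nonneg.2 (Real.log_nonpos (prob_pos _ _).le (prob_le_one _ _))

theorem Y_nonneg (ω : Omega S) (k : ℕ) : 0 ≤ Y k ω :=
  (neg_nonneg.2 (Real.log_nonpos (prob_pos _ (Classical.arbitrary _)).le (prob_le_one _ _))).trans
    (le_Y ω k _)

theorem log_two_le_Z (ω : Omega S) (k : ℕ) : Real.log 2 ≤ Z k ω := by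
  have h := Real.log_le_log (ratio_pos (ω k)) (ratio_le (ω k))
  rw [one_div, Real.log_inv] at h
  rw [Z]
  linarith

theorem sum_X_le_logLoss_sub {ω : Omega S} (i : (k : ℕ) → Fin (numChildren (ω k))) {n N : ℕ}
    (h : n ≤ N) : ∑ k ∈ Finset.range N, X k ω - ∑ k ∈ Finset.range n, X k ω ≤
      logLoss i N - logLoss i n := by
  rw [logLoss, logLoss, ← Finset.sum_Ico_eq_sub _ h, ← Finset.sum_Ico_eq_sub _ h]
  exact Finset.sum_le_sum fun k _ => X_le ω k _

theorem logLoss_sub_le_sum_Y {ω : Omega S} (i : (k : ℕ) → Fin (numChildren (ω k))) {n N : ℕ}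
    (h : n ≤ N) : logLoss i N - logLoss i n ≤
      ∑ k ∈ Finset.range N, Y k ω - ∑ k ∈ Finset.range n, Y k ω := by
  rw [logLoss, logLoss, ← Finset.sum_Ico_eq_sub _ h, ← Finset.sum_Ico_eq_sub _ h]
  exact Finset.sum_le_sum fun k _ => le_Y ω k _

/-! ### Sequences with converging averages -/

/-- Convergence handles large n; the finitely many remaining deviations are summed into K, which
makes the bound valid for all n. -/
theorem exists_abs_sub_le {s : ℕ → ℝ} {a : ℝ} (h : Tendsto (fun n : ℕ => s n / n) atTop (𝓝 a))
    {ε : ℝ} (hε : 0 < ε) : ∃ K, 0 ≤ K ∧ ∀ n : ℕ, |s n - a * n| ≤ ε * n + K := by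
  obtain ⟨n₀, hn₀⟩ := Metric.tendsto_atTop.1 h ε hε
  refine ⟨∑ n ∈ Finset.range (n₀ + 1), |s n - a * n|,
    Finset.sum_nonneg fun _ _ => abs_nonneg _, fun n => ?_⟩
  rcases lt_or_ge n (n₀ + 1) with hn | hn
  · have := Finset.single_le_sum (f := fun n : ℕ => |s n - a * n|) (fun _ _ => abs_nonneg _)
      (Finset.mem_range.2 hn)
    have h2 : 0 ≤ ε * n := by positivity
    linarith
  · have hpos : (0 : ℝ) < n := by exact_mod_cast (by omega : 0 < n)
    have h1 := (hn₀ n (by omega)).le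
    rw [Real.dist_eq] at h1
    have h2 : s n - a * n = (s n / n - a) * n := by field_simp
    rw [h2, abs_mul, abs_of_pos hpos]
    have h3 := mul_le_mul_of_nonneg_right h1 hpos.le
    have h4 : 0 ≤ ∑ n ∈ Finset.range (n₀ + 1), |s n - a * n| :=
      Finset.sum_nonneg fun _ _ => abs_nonneg _
    linarith

/-- Converts step count into logarithmic scale: with u = -log R, the sum up to a step matching R is
(a/b)u up to a small linear error. The window for u is wide enough for both ways of choosing the
step, by an inner and by an outer Moran set. -/
theorem exists_abs_sub_div_mul_le {s z : ℕ → ℝ} {a b : ℝ}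
    (hs : Tendsto (fun n : ℕ => s n / n) atTop (𝓝 a))
    (hz : Tendsto (fun n : ℕ => z n / n) atTop (𝓝 b)) (hb : 0 < b) {L : ℝ} (hL : 0 ≤ L)
    {ε : ℝ} (hε : 0 < ε) :
    ∃ K, ∀ (n : ℕ) (u : ℝ), z (n - 1) ≤ u → u ≤ z (n + 1) + L →
      |s n - a / b * u| ≤ ε * u + K := by
  set A := 1 + |a / b| with hA
  have hA1 : 1 ≤ A := by linarith [abs_nonneg (a / b)]
  -- The condition δ ≤ b/2 lets n be bounded by a multiple of u; the other one turns the total error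
  -- δ(1 + |a/b|)n into at most εu plus a constant. Below, M absorbs the index shift by one and L.
  obtain ⟨δ, hδ, hδb, hδε⟩ : ∃ δ, 0 < δ ∧ δ ≤ b / 2 ∧ δ * A * 2 ≤ ε * b := by
    refine ⟨min (b / 2) (ε * b / (2 * A)), by positivity, min_le_left _ _, ?_⟩
    have := min_le_right (b / 2) (ε * b / (2 * A))
    rw [le_div_iff₀ (by positivity)] at this
    linarith
  obtain ⟨K₁, hK₁, h₁⟩ := exists_abs_sub_le hs hδ
  obtain ⟨K₂, hK₂, h₂⟩ := exists_abs_sub_le hz hδ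
  set M := b + δ + K₂ + L
  refine ⟨ε * M + K₁ + |a / b| * M, fun n u hu1 hu2 => ?_⟩
  have hn1 : ((n - 1 : ℕ) : ℝ) ≤ n := by exact_mod_cast n.sub_le 1
  have hn2 : (n : ℝ) - 1 ≤ ((n - 1 : ℕ) : ℝ) := by
    rw [sub_le_iff_le_add]
    exact_mod_cast (by omega : n ≤ n - 1 + 1)
  have e1 := abs_le.1 (h₂ (n - 1))
  have e2 := abs_le.1 (h₂ (n + 1))
  push_cast at e2
  have e3 : |b * n - u| ≤ δ * n + M := by
    rw [abs_le]
    constructor <;> nlinarith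
  have hn : (n : ℝ) * b ≤ 2 * (u + M) := by
    have := (abs_le.1 e3).2
    have h0 : (0 : ℝ) ≤ n := n.cast_nonneg
    nlinarith
  have e4 : s n - a / b * u = (s n - a * n) + a / b * (b * n - u) := by
    field_simp
    ring
  have e5 : δ * A * n ≤ ε * (u + M) := by
    have h0 : (0 : ℝ) ≤ n := n.cast_nonneg
    have h1 : δ * A * 2 * n ≤ ε * b * n := mul_le_mul_of_nonneg_right hδε h0
    nlinarith
  calc |s n - a / b * u| ≤ |s n - a * n| + |a / b| * |b * n - u| := by
        rw [e4, ← abs_mul]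
        exact abs_add_le _ _
    _ ≤ (δ * n + K₁) + |a / b| * (δ * n + M) :=
        add_le_add (h₁ n) (mul_le_mul_of_nonneg_left e3 (abs_nonneg _))
    _ = δ * A * n + K₁ + |a / b| * M := by rw [hA]; ring
    _ ≤ ε * u + (ε * M + K₁ + |a / b| * M) := by linarith

theorem le_mul_of_forall_le {s z : ℕ → ℝ} {a b c d : ℝ}
    (hs : Tendsto (fun n : ℕ => s n / n) atTop (𝓝 a))
    (hz : Tendsto (fun n : ℕ => z n / n) atTop (𝓝 b))
    (h : ∀ᶠ n in atTop, s n ≤ d * z n + c) : a ≤ d * b := by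
  have h1 : Tendsto (fun n : ℕ => d * (z n / n) + c / n) atTop (𝓝 (d * b + 0)) :=
    (hz.const_mul d).add (tendsto_const_div_atTop_nhds_zero_nat c)
  rw [add_zero] at h1
  refine le_of_tendsto_of_tendsto hs h1 ?_
  filter_upwards [h] with n hn
  calc s n / n ≤ (d * z n + c) / n := div_le_div_of_nonneg_right hn n.cast_nonneg
    _ = d * (z n / n) + c / n := by ring

/-! ### Masses of balls -/

theorem zero_le_neg_log_τ (S : Setup D) : 0 ≤ -Real.log S.τ :=
  neg_nonneg.2 (Real.log_nonpos S.τ_pos.le S.τ_lt_one.le)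

theorem neg_log_le_of_lt_scale {ω : Omega S} {n : ℕ} {R : ℝ} (h : scale ω n < R) :
    -Real.log R ≤ ∑ k ∈ Finset.range n, Z k ω := by
  have := Real.log_le_log (scale_pos ω n) h.le
  rw [log_scale] at this
  linarith

theorem Z_nonneg (ω : Omega S) (k : ℕ) : 0 ≤ Z k ω :=
  (Real.log_nonneg (by norm_num)).trans (log_two_le_Z ω k)

theorem monotone_sum_range {f : ℕ → ℝ} (hf : ∀ k, 0 ≤ f k) :
    Monotone fun n => ∑ k ∈ Finset.range n, f k :=
  fun _ _ h => Finset.sum_le_sum_of_subset_of_nonneg (Finset.range_mono h) fun _ _ _ => hf _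

/-- Takes the first step whose sets have diameter below R, so that they fit in the ball. It is not
step 0, whose scale is 1 ≥ R. -/
theorem exists_scale_lt (ω : Omega S) {R : ℝ} (hR : 0 < R) (hR1 : R ≤ 1) :
    ∃ n, scale ω n < R ∧ ∑ k ∈ Finset.range (n - 1), Z k ω ≤ -Real.log R ∧
      -Real.log R ≤ ∑ k ∈ Finset.range n, Z k ω := by
  classical
  have hex : ∃ n, scale ω n < R := ((tendsto_scale ω).eventually_lt_const hR).exists
  have hlt := Nat.find_spec hex
  have h0 : Nat.find hex ≠ 0 := by
    intro h
    rw [h] at hlt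
    simp only [scale, Finset.range_zero, Finset.prod_empty] at hlt
    linarith
  have hmin := not_lt.1 (Nat.find_min hex (m := Nat.find hex - 1) (by omega))
  have hlog := Real.log_le_log hR hmin
  rw [log_scale] at hlog
  exact ⟨Nat.find hex, hlt, by linarith, neg_log_le_of_lt_scale hlt⟩

/-- Takes the last step at which separation still confines the ball to one Moran set. If R exceeds τ
there is none, and step 0 serves by default, as its set carries all the mass. -/
theorem exists_le_scale (ω : Omega S) {R : ℝ} (hR : 0 < R) (hR1 : R ≤ 1) :
    ∃ n, (R ≤ S.τ * scale ω n ∨ n = 0) ∧ ∑ k ∈ Finset.range n, Z k ω ≤ -Real.log R ∧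
      -Real.log R ≤ ∑ k ∈ Finset.range (n + 1), Z k ω + -Real.log S.τ := by
  classical
  have hτ := S.τ_pos
  have hL := zero_le_neg_log_τ S
  have hlog (n : ℕ) : Real.log (S.τ * scale ω n) =
      Real.log S.τ - ∑ k ∈ Finset.range n, Z k ω := by
    rw [Real.log_mul hτ.ne' (scale_pos ω n).ne', log_scale]
    ring
  have hex : ∃ n, S.τ * scale ω n < R := by
    have := (tendsto_scale ω).const_mul S.τ
    rw [mul_zero] at this
    exact (this.eventually_lt_const hR).exists
  have hlt := Real.log_le_log (mul_pos hτ (scale_pos ω _)) (Nat.find_spec hex).le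
  rw [hlog] at hlt
  rcases Nat.eq_zero_or_pos (Nat.find hex) with h0 | h0
  · refine ⟨0, Or.inr rfl, ?_, ?_⟩
    · simpa using Real.log_nonpos hR.le hR1
    · rw [h0] at hlt
      have := Z_nonneg ω 0
      simp only [Finset.range_zero, Finset.sum_empty, zero_add, Finset.range_one,
        Finset.sum_singleton] at hlt ⊢
      linarith
  · have hmin := not_lt.1 (Nat.find_min hex (m := Nat.find hex - 1) (by omega))
    have h1 := Real.log_le_log hR hmin
    rw [hlog] at h1
    refine ⟨Nat.find hex - 1, Or.inl hmin, by linarith, ?_⟩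
    rw [Nat.sub_add_cancel h0]
    linarith

theorem real_ball_pos {E : Type*} [PseudoMetricSpace E] [MeasurableSpace E] {μ : Measure E}
    [IsFiniteMeasure μ] {x : E} (hx : x ∈ μ.support) {r : ℝ} (hr : 0 < r) :
    0 < μ.real (Metric.ball x r) :=
  ENNReal.toReal_pos
    ((Measure.mem_support_iff_forall x).1 hx _ (Metric.ball_mem_nhds x hr)).ne' (measure_ne_top _ _)

namespace IsMoranMeasure

variable {ω : Omega S} {F : MoranFamily ω} {μ : Measure (EuclideanSpace ℝ (Fin D))}

theorem neg_log_real_ball_le (h : IsMoranMeasure F μ) {x : EuclideanSpace ℝ (Fin D)}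
    {i : (k : ℕ) → Fin (numChildren (ω k))} {n : ℕ} (hx : x ∈ F.set n (MoranFamily.wordOf i n))
    {R : ℝ} (hR : scale ω n < R) : -Real.log (μ.real (Metric.ball x R)) ≤ logLoss i n := by
  have h1 := h.le_real_ball hx hR
  rw [h.real_set, ← exp_neg_logLoss] at h1
  have := Real.log_le_log (Real.exp_pos _) h1
  rw [Real.log_exp] at this
  linarith

theorem le_neg_log_real_ball (h : IsMoranMeasure F μ) {x : EuclideanSpace ℝ (Fin D)}
    (hxs : x ∈ μ.support) {i : (k : ℕ) → Fin (numChildren (ω k))} {n : ℕ}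
    (hx : x ∈ F.set n (MoranFamily.wordOf i n)) {R : ℝ} (hR0 : 0 < R)
    (hR : R ≤ S.τ * scale ω n ∨ n = 0) : logLoss i n ≤ -Real.log (μ.real (Metric.ball x R)) := by
  have := h.isProbabilityMeasure
  rcases hR with hR | rfl
  · have h1 := h.real_ball_le hx hR
    rw [h.real_set, ← exp_neg_logLoss] at h1
    have := Real.log_le_log (real_ball_pos hxs hR0) h1
    rw [Real.log_exp] at this
    linarith
  · simpa [logLoss] using Real.log_nonpos measureReal_nonneg measureReal_le_one

variable {a b : ℝ}

/-- The mass of balls decays at least with the rate given by `X`, uniformly on the support. -/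
theorem le_log_real_ball_sub (h : IsMoranMeasure F μ)
    (hX : Tendsto (fun n : ℕ => (∑ k ∈ Finset.range n, X k ω) / n) atTop (𝓝 a))
    (hZ : Tendsto (fun n : ℕ => (∑ k ∈ Finset.range n, Z k ω) / n) atTop (𝓝 b)) (hb : 0 < b)
    {ε : ℝ} (hε : 0 < ε) : ∃ K, ∀ x ∈ μ.support, ∀ r R : ℝ, 0 < r → r ≤ R → R ≤ 1 →
      a / b * (Real.log R - Real.log r) - ε * (-Real.log R - Real.log r) - K ≤
        Real.log (μ.real (Metric.ball x R)) - Real.log (μ.real (Metric.ball x r)) := by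
  have := h.isProbabilityMeasure
  have hL := zero_le_neg_log_τ S
  have hmonoX := monotone_sum_range (X_nonneg ω)
  have hmonoZ := monotone_sum_range (Z_nonneg ω)
  obtain ⟨K, hK⟩ := exists_abs_sub_div_mul_le hX hZ hb hL hε
  refine ⟨2 * K, fun x hx r R hr hrR hR => ?_⟩
  obtain ⟨i, hi⟩ := h.exists_address hx
  obtain ⟨n, hn, hn1, hn2⟩ := exists_scale_lt ω (hr.trans_le hrR) hR
  obtain ⟨N, hN, hN1, hN2⟩ := exists_le_scale ω hr (hrR.trans hR)
  have e1 := h.neg_log_real_ball_le (hi n) hn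
  have e2 := h.le_neg_log_real_ball hx (hi N) hr hN
  have e3 := abs_le.1 (hK n _ hn1 (by have := hmonoZ n.le_succ; simp only at this; linarith))
  have e4 := abs_le.1 (hK N _ ((hmonoZ (Nat.sub_le N 1)).trans hN1) hN2)
  suffices hs : ∑ k ∈ Finset.range N, X k ω - ∑ k ∈ Finset.range n, X k ω ≤
      Real.log (μ.real (Metric.ball x R)) - Real.log (μ.real (Metric.ball x r)) by linarith
  -- The inner set for R may be of a later step than the outer set for r when the radii are close.
  -- Then the sum of X over the gap is nonpositive, and monotonicity of the measure suffices.
  rcases le_total n N with hnN | hnN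
  · have := sum_X_le_logLoss_sub i hnN
    linarith
  · have h1 := hmonoX hnN
    have h2 := Real.log_le_log (real_ball_pos hx hr)
      (measureReal_mono (Metric.ball_subset_ball (x := x) hrR) (measure_ne_top μ _))
    simp only at h1
    linarith

/-- The mass of balls decays at most with the rate given by `Y`, uniformly on the support. -/
theorem log_real_ball_sub_le (h : IsMoranMeasure F μ)
    (hY : Tendsto (fun n : ℕ => (∑ k ∈ Finset.range n, Y k ω) / n) atTop (𝓝 a))
    (hZ : Tendsto (fun n : ℕ => (∑ k ∈ Finset.range n, Z k ω) / n) atTop (𝓝 b)) (hb : 0 < b)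
    {ε : ℝ} (hε : 0 < ε) : ∃ K, ∀ x ∈ μ.support, ∀ r R : ℝ, 0 < r → r ≤ R → R ≤ 1 →
      Real.log (μ.real (Metric.ball x R)) - Real.log (μ.real (Metric.ball x r)) ≤
        a / b * (Real.log R - Real.log r) + ε * (-Real.log R - Real.log r) + K := by
  have := h.isProbabilityMeasure
  have hL := zero_le_neg_log_τ S
  have hmonoY := monotone_sum_range (Y_nonneg ω)
  have hmonoZ := monotone_sum_range (Z_nonneg ω)
  obtain ⟨K, hK⟩ := exists_abs_sub_div_mul_le hY hZ hb hL hε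
  refine ⟨2 * K, fun x hx r R hr hrR hR => ?_⟩
  obtain ⟨i, hi⟩ := h.exists_address hx
  obtain ⟨N, hN, hN1, hN2⟩ := exists_scale_lt ω hr (hrR.trans hR)
  obtain ⟨n, hn, hn1, hn2⟩ := exists_le_scale ω (hr.trans_le hrR) hR
  have e1 := h.neg_log_real_ball_le (hi N) hN
  have e2 := h.le_neg_log_real_ball hx (hi n) (hr.trans_le hrR) hn
  have e3 := abs_le.1 (hK N _ hN1 (by have := hmonoZ N.le_succ; simp only at this; linarith))
  have e4 := abs_le.1 (hK n _ ((hmonoZ (Nat.sub_le n 1)).trans hn1) hn2)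
  suffices hs : logLoss i N - logLoss i n ≤
      ∑ k ∈ Finset.range N, Y k ω - ∑ k ∈ Finset.range n, Y k ω by linarith
  -- Here the steps are always ordered: since each Z_k is at least log 2, n > N would force R < r.
  refine logLoss_sub_le_sum_Y i ?_
  by_contra hlt
  have h1 := Real.log_le_log hr hrR
  have h2 : ∑ k ∈ Finset.range n, Z k ω ≤ ∑ k ∈ Finset.range N, Z k ω := by linarith
  have h3 := hmonoZ (show N + 1 ≤ n by omega)
  simp only [Finset.sum_range_succ] at h3
  have h4 := log_two_le_Z ω N
  have h5 := Real.log_pos (show (1 : ℝ) < 2 by norm_num)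
  linarith

/-! ### Exponents -/

theorem le_of_forall_real_ball_le (h : IsMoranMeasure F μ)
    (hX : Tendsto (fun n : ℕ => (∑ k ∈ Finset.range n, X k ω) / n) atTop (𝓝 a))
    (hZ : Tendsto (fun n : ℕ => (∑ k ∈ Finset.range n, Z k ω) / n) atTop (𝓝 b)) (hb : 0 < b)
    {C r₀ d : ℝ} (hC : 0 < C) (hr₀ : 0 < r₀)
    (H : ∀ x ∈ μ.support, ∀ r, 0 < r → r < r₀ → μ.real (Metric.ball x r) ≤ C * r ^ d) :
    d ≤ a / b := by
  have := h.isProbabilityMeasure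
  obtain ⟨i, hi⟩ := exists_logLoss_eq_X ω
  have hev : ∀ᶠ n in atTop, -∑ k ∈ Finset.range n, X k ω ≤
      -d * ∑ k ∈ Finset.range n, Z k ω + (Real.log C + d * Real.log 2) := by
    filter_upwards [(tendsto_scale ω).eventually_lt_const (half_pos hr₀)] with n hn
    have hs := scale_pos ω n
    have hsupp := h.code_mem_support i
    have h1 := h.neg_log_real_ball_le (F.code_mem i n) (R := 2 * scale ω n) (by linarith)
    have h2 := Real.log_le_log (real_ball_pos hsupp (by positivity))
      (H _ hsupp (2 * scale ω n) (by positivity) (by linarith))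
    rw [Real.log_mul hC.ne' (by positivity), Real.log_rpow (by positivity),
      Real.log_mul two_ne_zero hs.ne', log_scale] at h2
    rw [hi] at h1
    linarith
  have hX' : Tendsto (fun n : ℕ => (-∑ k ∈ Finset.range n, X k ω) / n) atTop (𝓝 (-a)) := by
    simpa only [neg_div] using hX.neg
  have := le_mul_of_forall_le hX' hZ hev
  rw [le_div_iff₀ hb]
  linarith

/-- Only the point of the lightest address is tested, so the constants may depend on x. The radius τ
`scale ω n` is the largest for which separation bounds the ball by its Moran set. -/
theorem le_of_forall_le_real_ball (h : IsMoranMeasure F μ)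
    (hY : Tendsto (fun n : ℕ => (∑ k ∈ Finset.range n, Y k ω) / n) atTop (𝓝 a))
    (hZ : Tendsto (fun n : ℕ => (∑ k ∈ Finset.range n, Z k ω) / n) atTop (𝓝 b)) (hb : 0 < b)
    {d : ℝ} (H : ∀ x ∈ μ.support, ∃ c r₀ : ℝ, 0 < c ∧ 0 < r₀ ∧
      ∀ r, 0 < r → r < r₀ → c * r ^ d ≤ μ.real (Metric.ball x r)) :
    a / b ≤ d := by
  have hτ := S.τ_pos
  obtain ⟨i, hi⟩ := exists_logLoss_eq_Y ω
  have hsupp := h.code_mem_support i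
  obtain ⟨c, r₀, hc, hr₀, H⟩ := H _ hsupp
  have hev : ∀ᶠ n in atTop, ∑ k ∈ Finset.range n, Y k ω ≤
      d * ∑ k ∈ Finset.range n, Z k ω + -(Real.log c + d * Real.log S.τ) := by
    filter_upwards [(tendsto_scale ω).eventually_lt_const hr₀] with n hn
    have hs := scale_pos ω n
    have hlt : S.τ * scale ω n < r₀ := (mul_lt_of_lt_one_left hs S.τ_lt_one).trans hn
    have h1 := h.le_neg_log_real_ball hsupp (F.code_mem i n) (mul_pos hτ hs) (Or.inl le_rfl)
    have h2 := Real.log_le_log (by positivity) (H _ (mul_pos hτ hs) hlt)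
    rw [Real.log_mul hc.ne' (by positivity), Real.log_rpow (by positivity),
      Real.log_mul hτ.ne' hs.ne', log_scale] at h2
    rw [hi] at h1
    linarith
  rw [div_le_iff₀ hb]
  exact le_mul_of_forall_le hY hZ hev

end IsMoranMeasure

/-! ### Values of the dimensions -/

theorem sSup_coe_image_eq {A : Set ℝ} {α : ℝ} (h₁ : ∀ d < α, ∃ d' ∈ A, d ≤ d')
    (h₂ : ∀ d ∈ A, d ≤ α) : sSup ((fun d : ℝ => (d : EReal)) '' A) = α := by
  refine le_antisymm (sSup_le ?_) (le_of_forall_lt fun c hc => ?_)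
  · rintro _ ⟨d, hd, rfl⟩
    exact EReal.coe_le_coe_iff.2 (h₂ d hd)
  · obtain ⟨d, hcd, hd⟩ := EReal.lt_iff_exists_real_btwn.1 hc
    obtain ⟨d', hd', hdd'⟩ := h₁ d (EReal.coe_lt_coe_iff.1 hd)
    exact hcd.trans_le ((EReal.coe_le_coe_iff.2 hdd').trans (le_sSup (mem_image_of_mem _ hd')))

theorem sInf_coe_image_eq {A : Set ℝ} {α : ℝ} (h₁ : ∀ d, α < d → ∃ d' ∈ A, d' ≤ d)
    (h₂ : ∀ d ∈ A, α ≤ d) : sInf ((fun d : ℝ => (d : EReal)) '' A) = α := by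
  refine le_antisymm (le_of_forall_gt fun c hc => ?_) (le_sInf ?_)
  · obtain ⟨d, hd, hcd⟩ := EReal.lt_iff_exists_real_btwn.1 hc
    obtain ⟨d', hd', hdd'⟩ := h₁ d (EReal.coe_lt_coe_iff.1 hd)
    exact ((sInf_le (mem_image_of_mem _ hd')).trans (EReal.coe_le_coe_iff.2 hdd')).trans_lt hcd
  · rintro _ ⟨d, hd, rfl⟩
    exact EReal.coe_le_coe_iff.2 (h₂ d hd)

theorem neg_log_lt_of_lt_rpow {θ r R : ℝ} (hθ : 0 < θ) (hr : 0 < r) (hR : 0 < R)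
    (h : r < R ^ (1 + phiTheta θ R)) : -Real.log R < θ * -Real.log r := by
  have h1 := Real.log_lt_log hr h
  rw [Real.log_rpow hR, phiTheta, add_sub_cancel, one_div, inv_mul_eq_div, lt_div_iff₀ hθ] at h1
  linarith

theorem exp_mul_rpow_eq {K d q : ℝ} (hq : 0 < q) :
    Real.exp K * q ^ d = Real.exp (K + d * Real.log q) := by
  rw [Real.exp_add, Real.rpow_def_of_pos hq, mul_comm d]

namespace IsMoranMeasure

variable {ω : Omega S} {F : MoranFamily ω} {μ : Measure (EuclideanSpace ℝ (Fin D))} {a b : ℝ}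

theorem lowerPhiDim_eq (h : IsMoranMeasure F μ)
    (hX : Tendsto (fun n : ℕ => (∑ k ∈ Finset.range n, X k ω) / n) atTop (𝓝 a))
    (hZ : Tendsto (fun n : ℕ => (∑ k ∈ Finset.range n, Z k ω) / n) atTop (𝓝 b)) (hb : 0 < b)
    {θ : ℝ} (hθ : θ ∈ Ioo (0 : ℝ) 1) : lowerPhiDim (phiTheta θ) μ = (a / b : ℝ) := by
  have := h.isProbabilityMeasure
  refine sSup_coe_image_eq (fun d hd => ⟨d, ?_, le_rfl⟩) ?_
  -- With u = -log R < θv and v = -log r, one has (1-θ)(u+v) ≤ 2(1-θ)v ≤ 2(v-u). This ε therefore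
  -- makes the error at most (a/b - d) log(R/r), exactly the room available.
  · have hε : 0 < (a / b - d) * (1 - θ) / 2 :=
      half_pos (mul_pos (sub_pos.2 hd) (sub_pos.2 hθ.2))
    obtain ⟨K, hK⟩ := h.le_log_real_ball_sub hX hZ hb hε
    refine ⟨1 / 2, Real.exp (-K), by norm_num, by norm_num, Real.exp_pos _,
      fun r R hr hrR hRR hR x hx => ?_⟩
    have hR0 := pos_of_lt_rpow hr hrR hRR
    have hm := real_ball_pos hx hr
    have hM := real_ball_pos hx hR0
    have h1 := hK x hx r R hr (hrR.le.trans hRR) (by linarith)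
    have h2 := neg_log_lt_of_lt_rpow hθ.1 hr hR0 hrR
    have h3 := Real.log_le_log hr (hrR.le.trans hRR)
    rw [exp_mul_rpow_eq (div_pos hR0 hr), ← Real.exp_log (div_pos hM hm), Real.exp_le_exp,
      Real.log_div hR0.ne' hr.ne', Real.log_div hM.ne' hm.ne']
    have h4 : (1 - θ) * (-Real.log R - Real.log r) ≤ 2 * (Real.log R - Real.log r) := by
      have h5 := mul_le_mul_of_nonneg_left h3 (sub_pos.2 hθ.2).le
      linarith
    have h5 := mul_le_mul_of_nonneg_left h4 (sub_pos.2 hd).le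
    linarith
  · rintro d ⟨C₁, C₂, hC₁, hC₁', hC₂, H⟩
    have hr₀ : 0 < C₁ ^ (1 + phiTheta θ C₁) := Real.rpow_pos_of_pos hC₁ _
    -- Fix R = C₁ and bound the mass of the large ball by 1; the condition on ratios becomes a power
    -- bound on small balls.
    refine h.le_of_forall_real_ball_le hX hZ hb (C := (C₂ * C₁ ^ d)⁻¹) (by positivity) hr₀
      fun x hx r hr hrr => ?_
    have hm := real_ball_pos hx hr
    have h1 := H r C₁ hr hrr (rpow_phiTheta_le_self hθ.1 hθ.2 hC₁ le_rfl hC₁') le_rfl x hx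
    have h2 := h1.trans (div_le_div_of_nonneg_right measureReal_le_one hm.le)
    rw [Real.div_rpow hC₁.le hr.le, le_div_iff₀ hm] at h2
    have hrd : 0 < r ^ d := Real.rpow_pos_of_pos hr d
    rw [inv_mul_eq_div, le_div_iff₀ (by positivity)]
    have h3 : C₂ * (C₁ ^ d / r ^ d) * μ.real (Metric.ball x r) =
      μ.real (Metric.ball x r) * (C₂ * C₁ ^ d) / r ^ d := by ring
    rwa [h3, div_le_iff₀ hrd, one_mul] at h2

theorem upperPhiDim_eq (h : IsMoranMeasure F μ)
    (hY : Tendsto (fun n : ℕ => (∑ k ∈ Finset.range n, Y k ω) / n) atTop (𝓝 a))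
    (hZ : Tendsto (fun n : ℕ => (∑ k ∈ Finset.range n, Z k ω) / n) atTop (𝓝 b)) (hb : 0 < b)
    {θ : ℝ} (hθ : θ ∈ Ioo (0 : ℝ) 1) : upperPhiDim (phiTheta θ) μ = (a / b : ℝ) := by
  have := h.isProbabilityMeasure
  refine sInf_coe_image_eq (fun d hd => ⟨d, ?_, le_rfl⟩) ?_
  · have hε : 0 < (d - a / b) * (1 - θ) / 2 :=
      half_pos (mul_pos (sub_pos.2 hd) (sub_pos.2 hθ.2))
    obtain ⟨K, hK⟩ := h.log_real_ball_sub_le hY hZ hb hε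
    refine ⟨1 / 2, Real.exp K, by norm_num, by norm_num, Real.exp_pos _,
      fun r R hr hrR hRR hR x hx => ?_⟩
    have hR0 := pos_of_lt_rpow hr hrR hRR
    have hm := real_ball_pos hx hr
    have hM := real_ball_pos hx hR0
    have h1 := hK x hx r R hr (hrR.le.trans hRR) (by linarith)
    have h2 := neg_log_lt_of_lt_rpow hθ.1 hr hR0 hrR
    have h3 := Real.log_le_log hr (hrR.le.trans hRR)
    rw [exp_mul_rpow_eq (div_pos hR0 hr), ← Real.exp_log (div_pos hM hm), Real.exp_le_exp,
      Real.log_div hR0.ne' hr.ne', Real.log_div hM.ne' hm.ne']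
    have h4 : (1 - θ) * (-Real.log R - Real.log r) ≤ 2 * (Real.log R - Real.log r) := by
      have h5 := mul_le_mul_of_nonneg_left h3 (sub_pos.2 hθ.2).le
      linarith
    have h5 := mul_le_mul_of_nonneg_left h4 (sub_pos.2 hd).le
    linarith
  · rintro d ⟨C₁, C₂, hC₁, hC₁', hC₂, H⟩
    -- Again R = C₁, but the mass of the large ball now has to be bounded below, so it enters the
    -- constant, which depends on x.
    refine h.le_of_forall_le_real_ball hY hZ hb fun x hx =>
      ⟨μ.real (Metric.ball x C₁) / (C₂ * C₁ ^ d), C₁ ^ (1 + phiTheta θ C₁),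
        div_pos (real_ball_pos hx hC₁) (by positivity), by positivity, fun r hr hrr => ?_⟩
    have hm := real_ball_pos hx hr
    have h1 := H r C₁ hr hrr (rpow_phiTheta_le_self hθ.1 hθ.2 hC₁ le_rfl hC₁') le_rfl x hx
    have hrd : 0 < r ^ d := Real.rpow_pos_of_pos hr d
    rw [Real.div_rpow hC₁.le hr.le, div_le_iff₀ hm] at h1
    rw [div_mul_eq_mul_div, div_le_iff₀ (by positivity)]
    have h3 : C₂ * (C₁ ^ d / r ^ d) * μ.real (Metric.ball x r) =
      μ.real (Metric.ball x r) * (C₂ * C₁ ^ d) / r ^ d := by ring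
    rwa [h3, le_div_iff₀ hrd] at h1

theorem lowerQuasiAssouadDim_eq (h : IsMoranMeasure F μ)
    (hX : Tendsto (fun n : ℕ => (∑ k ∈ Finset.range n, X k ω) / n) atTop (𝓝 a))
    (hZ : Tendsto (fun n : ℕ => (∑ k ∈ Finset.range n, Z k ω) / n) atTop (𝓝 b)) (hb : 0 < b) :
    lowerQuasiAssouadDim μ = (a / b : ℝ) := by
  refine tendsto_nhds_unique (tendsto_lowerQuasiAssouadDim μ)
    (tendsto_const_nhds.congr' ?_)
  filter_upwards [Ioo_mem_nhdsLT zero_lt_one] with θ hθ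
  exact (h.lowerPhiDim_eq hX hZ hb hθ).symm

theorem upperQuasiAssouadDim_eq (h : IsMoranMeasure F μ)
    (hY : Tendsto (fun n : ℕ => (∑ k ∈ Finset.range n, Y k ω) / n) atTop (𝓝 a))
    (hZ : Tendsto (fun n : ℕ => (∑ k ∈ Finset.range n, Z k ω) / n) atTop (𝓝 b)) (hb : 0 < b) :
    upperQuasiAssouadDim μ = (a / b : ℝ) := by
  refine tendsto_nhds_unique (tendsto_upperQuasiAssouadDim μ)
    (tendsto_const_nhds.congr' ?_)
  filter_upwards [Ioo_mem_nhdsLT zero_lt_one] with θ hθ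
  exact (h.upperPhiDim_eq hY hZ hb hθ).symm

theorem frostmanDim_eq (h : IsMoranMeasure F μ)
    (hX : Tendsto (fun n : ℕ => (∑ k ∈ Finset.range n, X k ω) / n) atTop (𝓝 a))
    (hZ : Tendsto (fun n : ℕ => (∑ k ∈ Finset.range n, Z k ω) / n) atTop (𝓝 b)) (hb : 0 < b) :
    frostmanDim μ = (a / b : ℝ) := by
  have := h.isProbabilityMeasure
  -- Only nonnegative exponents compete, so a negative d is replaced by 0, which is always
  -- admissible.
  refine sSup_coe_image_eq (fun d hd => ⟨max d 0, ⟨le_max_right _ _, ?_⟩, le_max_left _ _⟩) ?_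
  · rcases le_total d 0 with hd0 | hd0
    · rw [max_eq_right hd0]
      exact ⟨1, one_pos, fun x _ r _ _ => by simp⟩
    · rw [max_eq_left hd0]
      obtain ⟨K, hK⟩ := h.le_log_real_ball_sub hX hZ hb (sub_pos.2 hd)
      refine ⟨Real.exp K, Real.exp_pos _, fun x hx r hr hr1 => ?_⟩
      have h1 := hK x hx r 1 hr hr1.le le_rfl
      have h2 : Real.log (μ.real (Metric.ball x 1)) ≤ 0 :=
        Real.log_nonpos measureReal_nonneg measureReal_le_one
      rw [exp_mul_rpow_eq hr, ← Real.exp_log (real_ball_pos hx hr), Real.exp_le_exp]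
      simp only [Real.log_one] at h1
      linarith
  · rintro d ⟨-, C, hC, H⟩
    exact h.le_of_forall_real_ball_le hX hZ hb hC one_pos H

theorem upperMinkowskiDim_eq (h : IsMoranMeasure F μ)
    (hY : Tendsto (fun n : ℕ => (∑ k ∈ Finset.range n, Y k ω) / n) atTop (𝓝 a))
    (hZ : Tendsto (fun n : ℕ => (∑ k ∈ Finset.range n, Z k ω) / n) atTop (𝓝 b)) (hb : 0 < b) :
    upperMinkowskiDim μ = (a / b : ℝ) := by
  have := h.isProbabilityMeasure
  have ha : 0 ≤ a := ge_of_tendsto' hY fun n =>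
    div_nonneg (Finset.sum_nonneg fun k _ => Y_nonneg ω k) n.cast_nonneg
  refine sInf_coe_image_eq (fun d hd => ⟨d, ⟨(div_nonneg ha hb.le).trans hd.le, ?_⟩, le_rfl⟩) ?_
  · obtain ⟨K, hK⟩ := h.log_real_ball_sub_le hY hZ hb (sub_pos.2 hd)
    -- The term `Y 0 ω` bounds the mass of the unit ball from below through a step-1 set. Step 0
    -- would not do: its diameter is 1, not less than 1.
    refine ⟨Real.exp (-(K + Y 0 ω)), Real.exp_pos _, fun x hx r hr hr1 => ?_⟩
    have h1 := hK x hx r 1 hr hr1.le le_rfl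
    obtain ⟨i, hi⟩ := h.exists_address hx
    have h2 := h.neg_log_real_ball_le (hi 1) (R := 1)
      ((scale_le ω 1).trans_lt (by norm_num))
    have h3 := logLoss_sub_le_sum_Y i zero_le_one
    simp only [logLoss, Finset.range_zero, Finset.sum_empty, sub_zero, Finset.range_one,
      Finset.sum_singleton] at h2 h3
    rw [exp_mul_rpow_eq hr, ← Real.exp_log (real_ball_pos hx hr), Real.exp_le_exp]
    simp only [Real.log_one] at h1
    linarith
  · rintro d ⟨-, c, hc, H⟩
    exact h.le_of_forall_le_real_ball hY hZ hb fun x hx => ⟨c, 1, hc, one_pos, H x hx⟩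

end IsMoranMeasure

end RandomMoran

theorem mainTheorem3 {D : ℕ} (S : Setup D) (π : Measure (Omega₀ S)) [IsProbabilityMeasure π]
    (hZ : HasExpMomentsNearZero (law π) (Z 0))
    (hX : HasExpMomentsNearZero (law π) (X 0))
    (hY : HasExpMomentsNearZero (law π) (Y 0)) :
    ∀ᵐ ω ∂(law π), ∀ F : MoranFamily ω,
      (lowerQuasiAssouadDim (moranMeasure F) = frostmanDim (moranMeasure F) ∧
        frostmanDim (moranMeasure F) =
          (((∫ η, X 0 η ∂(law π)) / (∫ η, Z 0 η ∂(law π)) : ℝ) : EReal)) ∧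
      (upperQuasiAssouadDim (moranMeasure F) = upperMinkowskiDim (moranMeasure F) ∧
        upperMinkowskiDim (moranMeasure F) =
          (((∫ η, Y 0 η ∂(law π)) / (∫ η, Z 0 η ∂(law π)) : ℝ) : EReal)) := by
  have hiX : Integrable (fun ω : Omega S => -Real.log (⨆ j, prob (ω 0) j)) (law π) := hX.integrable
  have hiY : Integrable (fun ω : Omega S => -Real.log (⨅ j, prob (ω 0) j)) (law π) := hY.integrable
  have hiZ : Integrable (fun ω : Omega S => -Real.log (ratio (ω 0))) (law π) := hZ.integrable
  -- All ratios are at most 1/2, so the mean of `Z` is at least log 2.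
  have hb : 0 < ∫ η, Z 0 η ∂(law π) := by
    have : IsProbabilityMeasure (law π) := by unfold law; infer_instance
    have h1 := integral_mono (μ := law π) (integrable_const (Real.log 2)) hZ.integrable
      fun ω => log_two_le_Z ω 0
    rw [integral_const, probReal_univ, one_smul] at h1
    exact (Real.log_pos one_lt_two).trans_le h1
  filter_upwards [ae_tendsto_average π (Real.measurable_log.comp measurable_iSup_prob).neg hiX,
    ae_tendsto_average π (Real.measurable_log.comp measurable_iInf_prob).neg hiY,
    ae_tendsto_average π (Real.measurable_log.comp measurable_ratio).neg hiZ] with ω h1 h2 h3 F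
  have hF := isMoranMeasure_moranMeasure F
  have eX := hF.frostmanDim_eq h1 h3 hb
  have eY := hF.upperMinkowskiDim_eq h2 h3 hb
  exact ⟨⟨(hF.lowerQuasiAssouadDim_eq h1 h3 hb).trans eX.symm, eX⟩,
    (hF.upperQuasiAssouadDim_eq h2 h3 hb).trans eY.symm, eY⟩
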